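/- For a matrix $A=(a_{ij})\in K^{n\times n}$ over a number field $K$, let $\mathcal H(A)$ denote the absolute multiplicative height of the point $(1:a_{11}:a_{12}:\dots:a_{nn})$ of the projective space $\mathbb P^{n^2}$. **Theorem.** Let $K$ be a number field, $n\ge 0$ and $s\ge 2$ integers, and $c>0$ a real number. There are a positive integer $R<s$ and a constant $C>0$, depending only on $K,n,s,c$, such that the following holds for every real $H\ge 2$. Let $A_1,\dots,A_s\in \mathrm{GL}_n(K)$ be pairwise commuting matrices, each diagonalizable (over the algebraic closure of $K$), with $\mathcal H(A_i)\le cH$ for $i=1,\dots,s$, and suppose that $$A_1^{k_1}\cdots A_s^{k_s}=I_n \qquad (*)$$ holds for some integers $k_1,\dots,k_s$ with $k_1\cdots k_s\neq 0$. Then there are integers $k_1,\dots,k_s$ with $k_1\cdots k_s\ne 0$ which satisfy $(*)$ and $$|k_i|\le C\,(\log H)^R\qquad (i=1,\dots,s).$$ -/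

import Mathlib

/-- The absolute multiplicative height of a square matrix `A = (a_{ij})` over a number field `K`,
i.e. the height of the point `(1 : a_{11} : ... : a_{nn})` of the projective space of dimension
`n ^ 2`.  (`Height.mulHeight` is the height relative to `K`, its `[K : ℚ]`-th root the absolute
one.)  The entry `none ↦ 1` is the additional homogeneous coordinate. -/
noncomputable def matrixHeight {K : Type*} [Field K] [NumberField K] {n : ℕ}
    (A : Matrix (Fin n) (Fin n) K) : ℝ :=
  (Height.mulHeight (fun o : Option (Fin n × Fin n) => o.elim (1 : K) (fun p => A p.1 p.2))) ^
    ((Module.finrank ℚ K : ℝ)⁻¹)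

/-- A square matrix over `K` is diagonalizable if it is similar to a diagonal matrix, where the
eigenvalues and the transformation matrix may have entries in the algebraic closure of `K`. -/
def IsDiagonalizableMatrix {K : Type*} [Field K] {n : ℕ} (A : Matrix (Fin n) (Fin n) K) : Prop :=
  ∃ (T : GL (Fin n) (AlgebraicClosure K)) (d : Fin n → AlgebraicClosure K),
    A.map (algebraMap K (AlgebraicClosure K)) =
      (T : Matrix (Fin n) (Fin n) (AlgebraicClosure K)) * Matrix.diagonal d *
        ((T⁻¹ : GL (Fin n) (AlgebraicClosure K)) :
          Matrix (Fin n) (Fin n) (AlgebraicClosure K))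

/-- The multiplicative relation `A_1 ^ k_1 * ... * A_s ^ k_s = I_n` with all exponents nonzero
(the product is taken in the order of the indices). -/
def IsMulRelation {K : Type*} [Field K] {n s : ℕ} (A : Fin s → GL (Fin n) K)
    (k : Fin s → ℤ) : Prop :=
  (∀ i, k i ≠ 0) ∧ (List.ofFn fun i => A i ^ k i).prod = 1

/-! Commuting diagonalizable matrices are simultaneously diagonalizable over the algebraic closure,
so the exponent vectors of relations form the subgroup `Λ` of `ℤ ^ s` cut out by `∏ χ_i ^ k_i = 1`
for all joint eigenvalues `χ`. Put `N χ k = logHeight₁ (∏ χ_i ^ k_i)`. This is homogeneous,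
invariant under `Λ`, and at most `h * ∑ |k_i|` with `h = O(log H)`, because eigenvalue heights are
controlled by the entries. By Northcott, `N χ k < η` for all `χ` forces `ω • k ∈ Λ`; here `ω` and
`η` depend only on `[K : ℚ] * n ^ s`, which bounds the degree of the field generated by the
coordinates of `χ`. That field varies with `χ`, so only the properties of `N` are passed on.

Given a possibly huge `w ∈ Λ` with largest coordinate `w m`, approximate the direction `w / w m` by
`k / q`. Then `|w m| * N χ k = N χ (w m • k - q • w)` is at most `|w m| * s * h / T`, so `T`
slightly above `s * h / η` gives `ω • k ∈ Λ`. One coordinate of `w / w m` is `1`, so Dirichlet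
allows `q ≤ T ^ (s - 1)`, whence the exponent `R = s - 1`.

The new vector may have zero coordinates, but its support lies in that of `w`. Starting from vectors
of minimal support through each index, one gets for every `i` a small element of `Λ` with nonzero
`i`-th coordinate (`exists_small_mem_forall_ne_zero`); a combination with bounded coefficients has
no zero coordinate. -/

/-! ### Diophantine approximation and combinations without zero coordinates -/

/-- Simultaneous Dirichlet approximation of a real vector with a coordinate equal to `1`. -/
theorem exists_nat_exists_int_abs_mul_sub_lt {s : ℕ} (v : Fin s → ℝ) (m : Fin s) (hm : v m = 1)
    {T : ℕ} (hT : 0 < T) :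
    ∃ q : ℕ, 0 < q ∧ q ≤ T ^ (s - 1) ∧ ∃ k : Fin s → ℤ, k m = q ∧
      ∀ i, |(q : ℝ) * v i - k i| < 1 / T := by
  have hT' : (0 : ℝ) < T := by exact_mod_cast hT
  have hlt (x : ℝ) : ⌊(T : ℝ) * Int.fract x⌋₊ < T := by
    rw [Nat.floor_lt (by positivity)]
    nlinarith [Int.fract_lt_one x]
  -- Pigeonhole: `T ^ (s - 1) + 1` multipliers, `T ^ (s - 1)` boxes. Coordinate `m` needs no box,
  -- since its multiples are integers.
  obtain ⟨a, b, hab, heq⟩ := Fintype.exists_ne_map_eq_of_card_lt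
    (fun (q : Fin (T ^ (s - 1) + 1)) (i : {i : Fin s // i ≠ m}) =>
      (⟨⌊(T : ℝ) * Int.fract ((q : ℕ) * v i)⌋₊, hlt _⟩ : Fin T)) (by
        simp [Fintype.card_subtype_compl])
  wlog h : a < b generalizing a b
  · exact this b a hab.symm heq.symm (lt_of_le_of_ne (not_lt.mp h) hab.symm)
  have hab' : (a : ℕ) < b := h
  refine ⟨b - a, by omega, by omega, fun i => ⌊((b : ℕ) : ℝ) * v i⌋ - ⌊((a : ℕ) : ℝ) * v i⌋, ?_, ?_⟩
  · simp [hm, Nat.cast_sub hab'.le]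
  · intro i
    have key : (((b - a : ℕ) : ℝ)) * v i -
        ((⌊((b : ℕ) : ℝ) * v i⌋ - ⌊((a : ℕ) : ℝ) * v i⌋ : ℤ) : ℝ) =
        Int.fract (((b : ℕ) : ℝ) * v i) - Int.fract (((a : ℕ) : ℝ) * v i) := by
      rw [Nat.cast_sub hab'.le, Int.fract, Int.fract]
      push_cast
      ring
    rw [key]
    by_cases hi : i = m
    · subst hi
      simpa [hm] using hT
    · have h1 : ⌊(T : ℝ) * Int.fract (((a : ℕ) : ℝ) * v i)⌋₊ =
          ⌊(T : ℝ) * Int.fract (((b : ℕ) : ℝ) * v i)⌋₊ := by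
        have := congrFun heq ⟨i, hi⟩
        simpa using this
      have ha0 : 0 ≤ (T : ℝ) * Int.fract (((a : ℕ) : ℝ) * v i) :=
        mul_nonneg hT'.le (Int.fract_nonneg _)
      have hb0 : 0 ≤ (T : ℝ) * Int.fract (((b : ℕ) : ℝ) * v i) :=
        mul_nonneg hT'.le (Int.fract_nonneg _)
      have h2 := Nat.floor_le ha0
      have h3 := Nat.lt_floor_add_one ((T : ℝ) * Int.fract (((a : ℕ) : ℝ) * v i))
      have h4 := Nat.floor_le hb0
      have h5 := Nat.lt_floor_add_one ((T : ℝ) * Int.fract (((b : ℕ) : ℝ) * v i))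
      rw [h1] at h2 h3
      rw [abs_lt, neg_lt, lt_div_iff₀ hT', lt_div_iff₀ hT']
      constructor <;> nlinarith

/-- Integer vectors, the `i`-th of which has nonzero `i`-th coordinate, have a combination with
small coefficients all of whose coordinates are nonzero. -/
theorem exists_sum_pow_mul_ne_zero {s : ℕ} (M : Fin s → Fin s → ℤ) (hM : ∀ i, M i i ≠ 0) :
    ∃ t : ℕ, t ≤ s * s ∧ ∀ j, ∑ i : Fin s, (t : ℤ) ^ (i : ℕ) * M i j ≠ 0 := by
  -- The `j`-th coordinate of the combination is `p j` evaluated at `t`, and the coefficient of `p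
  -- j` at `X ^ j` is `M j j`. The product of the `p j` has degree at most `s * s`, so it cannot
  -- vanish at all of `0, …, s * s`.
  let p : Fin s → Polynomial ℤ := fun j =>
    ∑ i : Fin s, Polynomial.C (M i j) * Polynomial.X ^ (i : ℕ)
  have hp (j : Fin s) : p j ≠ 0 := by
    intro h
    apply hM j
    have := congrArg (fun q => Polynomial.coeff q (j : ℕ)) h
    simpa [p, Polynomial.finsetSum_coeff, Polynomial.coeff_C_mul, Polynomial.coeff_X_pow,
      Fin.val_inj] using this
  have hdeg (j : Fin s) : (p j).natDegree ≤ s := by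
    refine Polynomial.natDegree_sum_le_of_forall_le _ _ fun i _ => ?_
    exact (Polynomial.natDegree_C_mul_X_pow_le _ _).trans i.isLt.le
  have hP : ∏ j, p j ≠ 0 := Finset.prod_ne_zero_iff.mpr fun j _ => hp j
  have hPdeg : (∏ j, p j).natDegree ≤ s * s := by
    refine (Polynomial.natDegree_prod_le _ _).trans ?_
    refine (Finset.sum_le_sum fun j _ => hdeg j).trans ?_
    simp
  by_contra! hcon
  apply hP
  refine Polynomial.eq_zero_of_natDegree_lt_card_of_eval_eq_zero' (∏ j, p j)
    ((Finset.range (s * s + 1)).map ⟨fun t : ℕ => (t : ℤ), Nat.cast_injective⟩) ?_ ?_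
  · intro x hx
    simp only [Finset.mem_map, Finset.mem_range, Function.Embedding.coeFn_mk] at hx
    obtain ⟨t, ht, rfl⟩ := hx
    obtain ⟨j, hj⟩ := hcon t (by omega)
    rw [Polynomial.eval_prod]
    refine Finset.prod_eq_zero (Finset.mem_univ j) ?_
    simp only [p, Polynomial.eval_finsetSum, Polynomial.eval_mul, Polynomial.eval_C,
      Polynomial.eval_pow, Polynomial.eval_X]
    rw [← hj]
    exact Finset.sum_congr rfl fun i _ => mul_comm _ _
  · simpa using Nat.lt_succ_of_le hPdeg

/-! ### Small vectors in subgroups of `ℤ ^ s` -/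

section Lattice

variable {s : ℕ} {X : Type*} (Λ : AddSubgroup (Fin s → ℤ)) (N : X → (Fin s → ℤ) → ℝ)
  {h η : ℝ} {ω T : ℕ}

/-- A nonzero element `w` of a subgroup of `ℤ ^ s` that is discrete for a family of seminorms
can be replaced by a small one with support contained in that of `w`. -/
theorem exists_small_mem_of_mem (hω : 0 < ω) (h0 : 0 ≤ h)
    (hsmul : ∀ χ (d : ℤ) k, N χ (d • k) = |(d : ℝ)| * N χ k)
    (hadd : ∀ χ, ∀ w ∈ Λ, ∀ k, N χ (k - w) = N χ k)
    (hle : ∀ χ k, N χ k ≤ h * ∑ i, |(k i : ℝ)|)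
    (htors : ∀ k, (∀ χ, N χ k < η) → (ω : ℤ) • k ∈ Λ)
    (hT0 : 0 < T) (hT : s * h < η * T) {w : Fin s → ℤ} (hw : w ∈ Λ) (hw0 : w ≠ 0) :
    ∃ k ∈ Λ, k ≠ 0 ∧ (∀ i, w i = 0 → k i = 0) ∧
      ∀ i, |(k i : ℝ)| ≤ ω * ((T : ℝ) ^ (s - 1) + 1) := by
  obtain ⟨i₀, hi₀⟩ := Function.ne_iff.mp hw0
  have : Nonempty (Fin s) := ⟨i₀⟩
  obtain ⟨m, hm⟩ := Finite.exists_max fun i => |(w i : ℝ)|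
  have hwm : (0 : ℝ) < |(w m : ℝ)| :=
    lt_of_lt_of_le (abs_pos.mpr (by exact_mod_cast hi₀)) (hm i₀)
  have hwm' : (w m : ℝ) ≠ 0 := abs_pos.mp hwm
  have hT' : (0 : ℝ) < T := by exact_mod_cast hT0
  obtain ⟨q, hq0, hqT, k, hkm, hk⟩ :=
    exists_nat_exists_int_abs_mul_sub_lt (fun i => (w i : ℝ) / w m) m (div_self hwm') hT0
  have hT1 : (1 : ℝ) / T ≤ 1 := by
    rw [div_le_one hT']
    exact_mod_cast hT0
  refine ⟨(ω : ℤ) • k, htors k fun χ => ?_, ?_, ?_, ?_⟩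
  -- Invariance under `w` turns the approximation error of the direction of `w` into a bound for `N
  -- χ k`; the size of `w` cancels.
  · have h1 : N χ (w m • k - (q : ℤ) • w) = |(w m : ℝ)| * N χ k := by
      rw [hadd χ _ (Λ.zsmul_mem hw _), hsmul]
    have h2 := hle χ (w m • k - (q : ℤ) • w)
    have h3 : ∑ i, |((w m • k - (q : ℤ) • w) i : ℝ)| ≤ |(w m : ℝ)| * (s * (1 / T)) := by
      calc ∑ i, |((w m • k - (q : ℤ) • w) i : ℝ)|
          ≤ ∑ _i : Fin s, |(w m : ℝ)| * (1 / T) := by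
            refine Finset.sum_le_sum fun i _ => ?_
            have : ((w m • k - (q : ℤ) • w) i : ℝ) =
                -(w m * ((q : ℝ) * ((w i : ℝ) / w m) - k i)) := by
              simp only [Pi.sub_apply, Pi.smul_apply, smul_eq_mul]
              push_cast
              field_simp
              ring
            rw [this, abs_neg, abs_mul]
            exact mul_le_mul_of_nonneg_left (hk i).le (abs_nonneg _)
        _ = _ := by
            rw [Finset.sum_const, Finset.card_univ, Fintype.card_fin, nsmul_eq_mul]
            ring
    rw [h1] at h2
    have h4 : |(w m : ℝ)| * N χ k ≤ |(w m : ℝ)| * (h * (s * (1 / T))) :=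
      h2.trans ((mul_le_mul_of_nonneg_left h3 h0).trans_eq (by ring))
    refine (le_of_mul_le_mul_left h4 hwm).trans_lt ?_
    rw [show h * (s * (1 / T)) = s * h / T by ring, div_lt_iff₀ hT']
    exact hT
  · intro hk0
    have := congrFun hk0 m
    simp only [Pi.smul_apply, hkm, smul_eq_mul, Pi.zero_apply, mul_eq_zero] at this
    omega
  · intro i hi
    have h1 := hk i
    simp only [hi, Int.cast_zero, zero_div, mul_zero, zero_sub, abs_neg] at h1
    have h2 : |(k i : ℝ)| < 1 := h1.trans_le hT1
    have h3 : |k i| < 1 := by exact_mod_cast h2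
    simp [Int.abs_lt_one_iff.mp h3]
  · intro i
    have h1 : |(w i : ℝ) / w m| ≤ 1 := by
      rw [abs_div, div_le_one hwm]
      exact hm i
    have h2 : |(k i : ℝ)| ≤ q * 1 + 1 := by
      calc |(k i : ℝ)| = |(q : ℝ) * ((w i : ℝ) / w m) - ((q : ℝ) * ((w i : ℝ) / w m) - k i)| := by
            congr 1
            ring
        _ ≤ |(q : ℝ) * ((w i : ℝ) / w m)| + |(q : ℝ) * ((w i : ℝ) / w m) - k i| := abs_sub _ _
        _ ≤ q * 1 + 1 := by
            rw [abs_mul, Nat.abs_cast]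
            gcongr
            exact (hk i).le.trans hT1
    have h3 : (q : ℝ) ≤ (T : ℝ) ^ (s - 1) := by exact_mod_cast hqT
    simp only [Pi.smul_apply, smul_eq_mul, Int.cast_mul, Int.cast_natCast, abs_mul, Nat.abs_cast]
    gcongr
    linarith

/-- A subgroup of `ℤ ^ s` that is discrete for a family of seminorms and contains a vector without
zero coordinates contains a small such vector. -/
theorem exists_small_mem_forall_ne_zero (hω : 0 < ω) (h0 : 0 ≤ h)
    (hsmul : ∀ χ (d : ℤ) k, N χ (d • k) = |(d : ℝ)| * N χ k)
    (hadd : ∀ χ, ∀ w ∈ Λ, ∀ k, N χ (k - w) = N χ k)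
    (hle : ∀ χ k, N χ k ≤ h * ∑ i, |(k i : ℝ)|)
    (htors : ∀ k, (∀ χ, N χ k < η) → (ω : ℤ) • k ∈ Λ)
    (hT0 : 0 < T) (hT : s * h < η * T) {w : Fin s → ℤ} (hw : w ∈ Λ) (hw0 : ∀ i, w i ≠ 0) :
    ∃ k ∈ Λ, (∀ i, k i ≠ 0) ∧
      ∀ i, |(k i : ℝ)| ≤ s * ((s * s + 1) ^ s * (ω * ((T : ℝ) ^ (s - 1) + 1))) := by
  classical
  have step (i : Fin s) : ∃ k ∈ Λ, k i ≠ 0 ∧ ∀ j, |(k j : ℝ)| ≤ ω * ((T : ℝ) ^ (s - 1) + 1) := by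
    -- Choose `u` of minimal support among elements of `Λ` with `u i ≠ 0`. If the small `k`
    -- supported in it had `k i = 0`, then for `k m ≠ 0` the vector `k m • u - u m • k` would keep a
    -- nonzero coordinate at `i` but lose `m`.
    have hex : ∃ n, ∃ u ∈ Λ, u i ≠ 0 ∧ (Finset.univ.filter fun j => u j ≠ 0).card = n :=
      ⟨_, w, hw, hw0 i, rfl⟩
    obtain ⟨u, hu, hui, hcard⟩ := Nat.find_spec hex
    obtain ⟨k, hk, hk0, hsupp, hbd⟩ := exists_small_mem_of_mem Λ N hω h0 hsmul hadd hle htors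
      hT0 hT hu (fun h => hui (by simp [h]))
    refine ⟨k, hk, fun hki => ?_, hbd⟩
    obtain ⟨m, hm⟩ := Function.ne_iff.mp hk0
    have hm : k m ≠ 0 := hm
    refine Nat.find_min hex (m := (Finset.univ.filter fun j => (k m • u - u m • k) j ≠ 0).card) ?_
      ⟨_, Λ.sub_mem (Λ.zsmul_mem hu _) (Λ.zsmul_mem hk _), by simp [hki, hm, hui], rfl⟩
    rw [← hcard]
    refine Finset.card_lt_card ⟨fun j => ?_, fun hsub => ?_⟩
    · simp only [Finset.mem_filter, Finset.mem_univ, true_and]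
      intro hj huj
      exact hj (by simp [huj, hsupp j huj])
    · have := @hsub m (by simpa using fun h => hm (hsupp m h))
      simp [mul_comm] at this
  choose M hM hMi hMb using step
  obtain ⟨t, ht, htj⟩ := exists_sum_pow_mul_ne_zero M hMi
  refine ⟨∑ i : Fin s, (t : ℤ) ^ (i : ℕ) • M i, Λ.sum_mem fun i _ => Λ.zsmul_mem (hM i) _, fun j => ?_,
    fun j => ?_⟩
  · simpa using htj j
  · simp only [Finset.sum_apply, Pi.smul_apply, smul_eq_mul]
    push_cast
    refine (Finset.abs_sum_le_sum_abs _ _).trans ?_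
    calc ∑ i : Fin s, |(t : ℝ) ^ (i : ℕ) * (M i j : ℝ)|
        ≤ ∑ _i : Fin s, ((s * s + 1 : ℝ) ^ s * (ω * ((T : ℝ) ^ (s - 1) + 1))) := by
          refine Finset.sum_le_sum fun i _ => ?_
          rw [abs_mul]
          refine mul_le_mul ?_ (hMb i j) (abs_nonneg _) (by positivity)
          rw [abs_of_nonneg (by positivity)]
          have ht' : (t : ℝ) ≤ s * s + 1 := by
            have : (t : ℝ) ≤ ((s * s : ℕ) : ℝ) := by exact_mod_cast ht
            push_cast at this
            linarith
          calc (t : ℝ) ^ (i : ℕ) ≤ (s * s + 1 : ℝ) ^ (i : ℕ) := by gcongr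
            _ ≤ (s * s + 1 : ℝ) ^ s :=
              pow_le_pow_right₀ (by nlinarith [sq_nonneg (s : ℝ)]) i.isLt.le
      _ = _ := by
          rw [Finset.sum_const, Finset.card_univ, Fintype.card_fin, nsmul_eq_mul]

end Lattice

/-! ### Heights, a uniform Northcott theorem, and heights of eigenvalues -/

section Heights

open Height NumberField

variable {L : Type*} [Field L] [NumberField L]

/-- All local factors of the height are at least `1`, so their product dominates the factor at the
place of `φ`. -/
theorem NumberField.norm_embedding_le_mulHeight₁ (x : L) (φ : L →+* ℂ) : ‖φ x‖ ≤ mulHeight₁ x := by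
  classical
  refine (InfinitePlace.le_iff_le x _).mp (fun w => ?_) φ
  rw [NumberField.mulHeight₁_eq]
  have h1 : w x ≤ max (w x) 1 ^ w.mult :=
    (le_max_left _ _).trans (le_self_pow₀ (le_max_right _ _) w.mult_ne_zero)
  have h2 : max (w x) 1 ^ w.mult ≤ ∏ v : InfinitePlace L, max (v x) 1 ^ v.mult := by
    rw [← Finset.mul_prod_erase _ _ (Finset.mem_univ w)]
    refine le_mul_of_one_le_right (by positivity) ?_
    exact Finset.prod_const_one.symm.trans_le
      (Finset.prod_le_prod (fun _ _ => zero_le_one) fun v _ => one_le_pow₀ (le_max_right _ _))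
  have h3 : 1 ≤ ∏ᶠ v : FinitePlace L, max (v x) 1 := one_le_finprod fun v => le_max_right _ _
  exact (h1.trans h2).trans (le_mul_of_one_le_right (Finset.prod_nonneg fun v _ => by positivity) h3)

/-- Finite places contribute `1` for an algebraic integer, and the multiplicities of the infinite
places add up to the degree. -/
theorem NumberField.mulHeight₁_le_pow_finrank {x : L} (hx : IsIntegral ℤ x) {B : ℝ} (hB : 1 ≤ B)
    (h : ∀ φ : L →+* ℂ, ‖φ x‖ ≤ B) : mulHeight₁ x ≤ B ^ Module.finrank ℚ L := by
  rw [NumberField.mulHeight₁_eq, finprod_eq_one_of_forall_eq_one, mul_one,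
    ← totalWeight_eq_finrank, totalWeight_eq_sum_mult, ← Finset.prod_pow_eq_pow_sum]
  · refine Finset.prod_le_prod (fun v _ => by positivity) fun v _ => ?_
    gcongr
    exact max_le ((InfinitePlace.le_iff_le x B).mpr h v) hB
  · intro v
    refine max_eq_right ?_
    rw [← FinitePlace.norm_embedding_eq]
    exact FinitePlace.norm_le_one L v.maximalIdeal (⟨x, hx⟩ : 𝓞 L)

/-- Algebraic numbers of bounded height and degree form a finite set, even when each height is
taken relative to its own field of bounded degree. -/
theorem NumberField.exists_finite_forall_ringHom_mem (D : ℕ) (B : ℝ) :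
    ∃ S : Set (AlgebraicClosure ℚ), S.Finite ∧ ∀ (L : Type*) [Field L] [NumberField L],
      Module.finrank ℚ L ≤ D → ∀ (f : L →+* AlgebraicClosure ℚ) (x : L),
        mulHeight₁ x ≤ B → f x ∈ S := by
  classical
  -- `E` bounds the coefficients of a minimal polynomial of degree at most `D` with roots of size at
  -- most `B * B`: one factor `B` for the conjugates of `x`, one for the denominator `n` clearing
  -- `x`.
  obtain ⟨E, hE⟩ : ∃ E : ℕ, max (B * B) 1 ^ D * ((2 ^ D : ℕ) : ℝ) ≤ E := exists_nat_ge _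
  have hU := Polynomial.bUnion_roots_finite (algebraMap ℤ (AlgebraicClosure ℚ)) D
    (Set.finite_Icc (-E : ℤ) E)
  set U := ⋃ (f : Polynomial ℤ) (_ : f.natDegree ≤ D ∧ ∀ i, f.coeff i ∈ Set.Icc (-E : ℤ) E),
        ((f.map (algebraMap ℤ (AlgebraicClosure ℚ))).roots.toFinset :
          Set (AlgebraicClosure ℚ)) with hUdef
  refine ⟨⋃ n ∈ Finset.Icc 1 ⌊B⌋₊, (fun y => y / (n : AlgebraicClosure ℚ)) '' U,
    Set.Finite.biUnion (Finset.finite_toSet _) fun n _ => hU.image _, ?_⟩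
  intro L _ _ hD f x hx
  obtain ⟨n, hn0, hnx, hint⟩ := exists_nat_le_mulHeight₁ x
  have hB : 1 ≤ B := (one_le_mulHeight₁ x).trans hx
  have hnorm (φ : L →+* ℂ) : ‖φ (n * x)‖ ≤ B * B := by
    rw [map_mul, norm_mul, map_natCast, Complex.norm_natCast]
    exact mul_le_mul (hnx.trans hx) ((norm_embedding_le_mulHeight₁ x φ).trans hx)
      (norm_nonneg _) (by linarith)
  simp only [Set.mem_iUnion, Set.mem_image, Finset.mem_Icc]
  refine ⟨n, ⟨Nat.one_le_iff_ne_zero.mpr hn0, Nat.le_floor (hnx.trans hx)⟩, f (n * x), ?_, ?_⟩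
  · have hmin := minpoly.isIntegrallyClosed_eq_field_fractions' ℚ hint
    rw [hUdef]
    simp only [Set.mem_iUnion]
    refine ⟨minpoly ℤ (n * x), ⟨?_, fun i => ?_⟩, ?_⟩
    · rw [← (minpoly.monic hint).natDegree_map (algebraMap ℤ ℚ), ← hmin]
      exact (minpoly.natDegree_le _).trans hD
    · rw [Set.mem_Icc, ← abs_le, ← @Int.cast_le ℝ]
      have hc := Embeddings.coeff_bdd_of_norm_le hnorm i
      rw [hmin, Polynomial.coeff_map, eq_intCast, Int.norm_cast_rat, Int.norm_eq_abs,
        ← Int.cast_abs] at hc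
      refine hc.trans (le_trans ?_ (hE.trans_eq (by simp)))
      have h1 : (Module.finrank ℚ L).choose (Module.finrank ℚ L / 2) ≤ 2 ^ D :=
        (Nat.choose_le_two_pow _ _).trans (Nat.pow_le_pow_right (by norm_num) hD)
      refine mul_le_mul (pow_le_pow_right₀ (le_max_right _ _) hD) (by exact_mod_cast h1)
        (by positivity) (by positivity)
    · rw [Finset.mem_coe, Multiset.mem_toFinset,
        Polynomial.mem_roots ((minpoly.monic hint).map _).ne_zero, Polynomial.IsRoot,
        Polynomial.eval_map]
      have h2 : algebraMap ℤ (AlgebraicClosure ℚ) = f.comp (algebraMap ℤ L) :=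
        RingHom.ext_int _ _
      rw [h2, ← Polynomial.hom_eval₂, ← Polynomial.aeval_def, minpoly.aeval, map_zero]
  · have : (n : AlgebraicClosure ℚ) ≠ 0 := by exact_mod_cast hn0
    rw [map_mul, map_natCast]
    field_simp

/-- In number fields of bounded degree, elements of small height are roots of unity of bounded
order. -/
theorem NumberField.exists_forall_pow_eq_one_of_logHeight₁_lt (D : ℕ) :
    ∃ ω : ℕ, 0 < ω ∧ ∃ η : ℝ, 0 < η ∧ ∀ (L : Type*) [Field L] [NumberField L],
      Module.finrank ℚ L ≤ D → ∀ x : L, x ≠ 0 → logHeight₁ x < η → x ^ ω = 1 := by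
  obtain ⟨S, hS, hmem⟩ := NumberField.exists_finite_forall_ringHom_mem D 2
  set M := hS.toFinset.card with hM
  -- With this `η` the powers `x ^ 0, …, x ^ M` all have height at most `2`. Two of them coincide,
  -- so the order of `x` is at most `M` and divides `M!`.
  refine ⟨M.factorial, M.factorial_pos, Real.log 2 / (M + 1), by positivity, ?_⟩
  intro L _ _ hD x hx0 hx
  let f : L →+* AlgebraicClosure ℚ := (IsAlgClosed.lift : L →ₐ[ℚ] AlgebraicClosure ℚ).toRingHom
  have hpow (j : ℕ) (hj : j ∈ Finset.range (M + 1)) : f (x ^ j) ∈ hS.toFinset := by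
    rw [Set.Finite.mem_toFinset]
    refine hmem L hD f _ ?_
    rw [← Real.log_le_log_iff (mulHeight₁_pos _) (by norm_num), ← logHeight₁_eq_log_mulHeight₁,
      logHeight₁_pow]
    rw [lt_div_iff₀ (by positivity)] at hx
    have hj' : (j : ℝ) ≤ M := by
      rw [Finset.mem_range] at hj
      exact_mod_cast Nat.lt_succ_iff.mp hj
    nlinarith [zero_le_logHeight₁ x]
  obtain ⟨a, ha, b, hb, hab, heq⟩ := Finset.exists_ne_map_eq_of_card_lt_of_maps_to
    (by simp [hM]) hpow
  wlog h : a < b generalizing a b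
  · exact this b hb a ha hab.symm heq.symm (lt_of_le_of_ne (not_lt.mp h) hab.symm)
  have heq' : x ^ a = x ^ b := f.injective heq
  have h1 : x ^ (b - a) = 1 := by
    rw [pow_sub₀ x hx0 h.le, ← heq', mul_inv_cancel₀ (pow_ne_zero _ hx0)]
  rw [Finset.mem_range] at hb
  obtain ⟨c, hc⟩ := Nat.dvd_factorial (Nat.sub_pos_of_lt h) (show b - a ≤ M by omega)
  rw [hc, pow_mul, h1, one_pow]

/-- The height of an eigenvalue of a matrix is bounded in terms of the heights of the entries. -/
theorem NumberField.mulHeight₁_le_of_aeval_charpoly_eq_zero {K : Type*} [Field K] [NumberField K]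
    [Algebra K L] {n : ℕ} (A : Matrix (Fin n) (Fin n) K) {X : ℝ} (hX : 1 ≤ X)
    (hA : ∀ i j, mulHeight₁ (A i j) ≤ X) {μ : L} (hμ : Polynomial.aeval μ A.charpoly = 0) :
    mulHeight₁ μ ≤ ((n + 1) * X ^ (2 * (n * n) + 1)) ^ Module.finrank ℚ L := by
  classical
  choose d hd0 hdX hdint using fun p : Fin n × Fin n => exists_nat_le_mulHeight₁ (A p.1 p.2)
  set e := ∏ p, d p with he
  have he0 : e ≠ 0 := Finset.prod_ne_zero_iff.mpr fun p _ => hd0 p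
  have he1 : (1 : ℝ) ≤ e := by exact_mod_cast Nat.one_le_iff_ne_zero.mpr he0
  have heX : (e : ℝ) ≤ X ^ (n * n) := by
    rw [he, Nat.cast_prod]
    refine (Finset.prod_le_prod (fun p _ => Nat.cast_nonneg _)
      fun p _ => (hdX p).trans (hA _ _)).trans ?_
    simp
  have heint (i j : Fin n) : IsIntegral ℤ ((e : K) * A i j) := by
    have h1 : (e : K) = (∏ p ∈ Finset.univ.erase (i, j), d p : ℕ) * d (i, j) := by
      rw [he, ← Finset.prod_erase_mul _ _ (Finset.mem_univ (i, j))]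
      push_cast
      ring
    rw [h1, mul_assoc]
    refine IsIntegral.mul ?_ (hdint (i, j))
    simpa using isIntegral_algebraMap (R := ℤ) (A := K)
      (x := ((∏ p ∈ Finset.univ.erase (i, j), d p : ℕ) : ℤ))
  have heL : (e : L) ≠ 0 := by exact_mod_cast he0
  have hroot : (A.map (algebraMap K L)).charpoly.eval μ = 0 := by
    rw [Polynomial.aeval_def, ← Polynomial.eval_map] at hμ
    rwa [← (algebraMap K L).mapMatrix_apply, RingHom.mapMatrix_apply, Matrix.charpoly_map]
  -- `e * μ` is a root of the characteristic polynomial of `e • A`, which has entries in `𝓞 K`.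
  have hint : IsIntegral ℤ ((e : L) * μ) := by
    let B : Matrix (Fin n) (Fin n) (𝓞 K) := fun i j => ⟨(e : K) * A i j, heint i j⟩
    have hB : B.map (algebraMap (𝓞 K) L) = (e : L) • A.map (algebraMap K L) := by
      ext i j
      rw [Matrix.map_apply, IsScalarTower.algebraMap_apply (𝓞 K) K L]
      change algebraMap K L ((e : K) * A i j) = _
      simp
    have h1 : IsIntegral (𝓞 K) ((e : L) * μ) := by
      refine ⟨B.charpoly, B.charpoly_monic, ?_⟩
      rw [← Polynomial.eval_map, ← Matrix.charpoly_map, hB, Matrix.eval_charpoly]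
      have h2 : Matrix.scalar (Fin n) ((e : L) * μ) - (e : L) • A.map (algebraMap K L) =
          (e : L) • (Matrix.scalar (Fin n) μ - A.map (algebraMap K L)) := by
        rw [smul_sub]
        congr 1
        ext i j
        simp [Matrix.diagonal_apply]
      rw [h2, Matrix.det_smul, ← Matrix.eval_charpoly, hroot, mul_zero]
    exact isIntegral_trans _ h1
  -- Gershgorin's circle theorem, applied to each conjugate of `A`.
  have hemb (φ : L →+* ℂ) : ‖φ μ‖ ≤ (n + 1) * X := by
    have h1 : Module.End.HasEigenvalue
        (Matrix.toLin' (A.map (φ.comp (algebraMap K L)))) (φ μ) := by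
      rw [Module.End.hasEigenvalue_iff_isRoot_charpoly, Matrix.charpoly_toLin', Matrix.charpoly_map,
        Polynomial.IsRoot, Polynomial.eval_map, ← Polynomial.hom_eval₂, ← Polynomial.aeval_def, hμ,
        map_zero]
    obtain ⟨k, hk⟩ := eigenvalue_mem_ball h1
    have hent (i j : Fin n) : ‖(A.map (φ.comp (algebraMap K L))) i j‖ ≤ X :=
      (norm_embedding_le_mulHeight₁ (A i j) (φ.comp (algebraMap K L))).trans (hA i j)
    rw [Metric.mem_closedBall, dist_eq_norm] at hk
    have h2 : ∑ j ∈ Finset.univ.erase k, ‖(A.map (φ.comp (algebraMap K L))) k j‖ ≤ n * X := by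
      refine (Finset.sum_le_sum_of_subset_of_nonneg (Finset.erase_subset _ _)
        fun _ _ _ => norm_nonneg _).trans ((Finset.sum_le_sum fun j _ => hent k j).trans ?_)
      simp
    have h3 := norm_le_norm_add_norm_sub' (φ μ) ((A.map (φ.comp (algebraMap K L))) k k)
    linarith [hent k k]
  have h1 : mulHeight₁ ((e : L) * μ) ≤ (e * ((n + 1) * X)) ^ Module.finrank ℚ L := by
    refine mulHeight₁_le_pow_finrank hint ?_ fun φ => ?_
    · have : (1 : ℝ) ≤ n + 1 := by linarith [Nat.cast_nonneg (α := ℝ) n]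
      exact one_le_mul_of_one_le_of_one_le he1 (one_le_mul_of_one_le_of_one_le this hX)
    · rw [map_mul, norm_mul, map_natCast, Complex.norm_natCast]
      exact mul_le_mul_of_nonneg_left (hemb φ) (by positivity)
  have h2 : mulHeight₁ (e : L) ≤ (e : ℝ) ^ Module.finrank ℚ L :=
    mulHeight₁_le_pow_finrank (by simpa using isIntegral_algebraMap (R := ℤ) (A := L) (x := (e : ℤ)))
      he1 fun φ => by simp
  -- The denominator `e ≤ X ^ (n * n)` is paid for twice, in `e * μ` and in dividing by `e`;
  -- Gershgorin gives the remaining factor `X`.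
  calc mulHeight₁ μ = mulHeight₁ ((e : L) * μ * (e : L)⁻¹) := by
        rw [mul_comm (e : L), mul_assoc, mul_inv_cancel₀ heL, mul_one]
    _ ≤ mulHeight₁ ((e : L) * μ) * mulHeight₁ (e : L) := by
        rw [← mulHeight₁_inv (e : L)]
        exact mulHeight₁_mul_le _ _
    _ ≤ (e * ((n + 1) * X)) ^ Module.finrank ℚ L * (e : ℝ) ^ Module.finrank ℚ L := by
        gcongr
    _ = (e * e * ((n + 1) * X)) ^ Module.finrank ℚ L := by
        rw [← mul_pow]
        ring
    _ ≤ (X ^ (n * n) * X ^ (n * n) * ((n + 1) * X)) ^ Module.finrank ℚ L := by gcongr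
    _ = _ := by ring

end Heights

/-! ### Relations between matrices and between joint eigenvalues -/

section JointEigenvectors

variable {F : Type*} [Field F] {n s : ℕ}

/-- `χ` is a joint eigenvalue of the matrices `A i`. -/
def IsJointEigenvalue (A : Fin s → Matrix (Fin n) (Fin n) F) (χ : Fin s → F) : Prop :=
  ∃ v : Fin n → F, v ≠ 0 ∧ ∀ i, (A i).mulVec v = χ i • v

/-- The columns of `T` are eigenvectors and span. Semisimplicity is needed to replace generalized
eigenspaces by eigenspaces. -/
theorem Matrix.toLin'_isSemisimple_of_eq_mul_diagonal_mul_inv {A : Matrix (Fin n) (Fin n) F}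
    {T : GL (Fin n) F} {d : Fin n → F}
    (h : A = (T : Matrix (Fin n) (Fin n) F) * Matrix.diagonal d * (T⁻¹ : GL (Fin n) F)) :
    Module.End.IsSemisimple (Matrix.toLin' A) ∧
      ⨆ μ, Module.End.eigenspace (Matrix.toLin' A) μ = ⊤ := by
  classical
  have hcol (j : Fin n) : A.mulVec ((T : Matrix (Fin n) (Fin n) F).mulVec (Pi.single j 1)) =
      d j • (T : Matrix (Fin n) (Fin n) F).mulVec (Pi.single j 1) := by
    rw [h, Matrix.mulVec_mulVec, Matrix.mul_assoc, Matrix.mul_assoc, ← Units.val_mul,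
      inv_mul_cancel, Units.val_one, Matrix.mul_one, ← Matrix.mulVec_mulVec,
      Matrix.diagonal_mulVec_single, ← Matrix.mulVec_smul]
    congr 1
    ext i
    simp [Pi.single_apply]
  have htop (W : Submodule F (Fin n → F))
      (hW : ∀ j, (T : Matrix (Fin n) (Fin n) F).mulVec (Pi.single j 1) ∈ W) : W = ⊤ := by
    rw [eq_top_iff]
    intro v _
    have h1 : v = (T : Matrix (Fin n) (Fin n) F).mulVec
        (((T⁻¹ : GL (Fin n) F) : Matrix (Fin n) (Fin n) F).mulVec v) := by
      rw [Matrix.mulVec_mulVec, ← Units.val_mul, mul_inv_cancel, Units.val_one, Matrix.one_mulVec]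
    rw [h1, pi_eq_sum_univ' (((T⁻¹ : GL (Fin n) F) : Matrix (Fin n) (Fin n) F).mulVec v),
      Matrix.mulVec_sum]
    refine W.sum_mem fun j _ => ?_
    rw [Matrix.mulVec_smul]
    refine W.smul_mem _ ?_
    convert hW j using 2
  constructor
  -- Taking the image of `d` discards repeated eigenvalues, so the annihilating polynomial is
  -- squarefree.
  · refine Module.End.isSemisimple_of_squarefree_aeval_eq_zero
      (p := ∏ μ ∈ Finset.univ.image d, (Polynomial.X - Polynomial.C μ)) ?_ ?_
    · exact (Polynomial.separable_prod_X_sub_C_iff'.mpr fun _ _ _ _ h => h).squarefree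
    · rw [← LinearMap.ker_eq_top]
      refine htop _ fun j => ?_
      rw [LinearMap.mem_ker]
      have hmem : (T : Matrix (Fin n) (Fin n) F).mulVec (Pi.single j 1) ∈
          Module.End.eigenspace (Matrix.toLin' A) (d j) := by
        rw [Module.End.mem_eigenspace_iff, Matrix.toLin'_apply, hcol]
      by_cases h0 : (T : Matrix (Fin n) (Fin n) F).mulVec (Pi.single j 1) = 0
      · rw [h0, map_zero]
      · rw [Module.End.aeval_apply_of_hasEigenvector ⟨hmem, h0⟩, Polynomial.eval_prod,
          Finset.prod_eq_zero (Finset.mem_image_of_mem d (Finset.mem_univ j)) (by simp), zero_smul]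
  · refine htop _ fun j => ?_
    refine Submodule.mem_iSup_of_mem (d j) ?_
    rw [Module.End.mem_eigenspace_iff, Matrix.toLin'_apply, hcol]

theorem mulVec_inv_of_mulVec {A : GL (Fin n) F} {μ : F} (hμ : μ ≠ 0) {v : Fin n → F}
    (h : (A : Matrix (Fin n) (Fin n) F).mulVec v = μ • v) :
    ((A⁻¹ : GL (Fin n) F) : Matrix (Fin n) (Fin n) F).mulVec v = μ⁻¹ • v := by
  have h1 : ((A⁻¹ : GL (Fin n) F) : Matrix (Fin n) (Fin n) F).mulVec (μ • v) = v := by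
    rw [← h, Matrix.mulVec_mulVec, ← Units.val_mul, inv_mul_cancel, Units.val_one,
      Matrix.one_mulVec]
  rw [Matrix.mulVec_smul] at h1
  rw [eq_inv_smul_iff₀ hμ, h1]

theorem ne_zero_of_mulVec_eq_smul {A : GL (Fin n) F} {μ : F} {v : Fin n → F} (hv : v ≠ 0)
    (h : (A : Matrix (Fin n) (Fin n) F).mulVec v = μ • v) : μ ≠ 0 := by
  rintro rfl
  apply hv
  rw [← Matrix.one_mulVec v, ← Units.val_one, ← inv_mul_cancel A, Units.val_mul,
    ← Matrix.mulVec_mulVec, h, zero_smul, Matrix.mulVec_zero]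

theorem mulVec_zpow_of_mulVec {A : GL (Fin n) F} {μ : F} (hμ : μ ≠ 0) {v : Fin n → F}
    (h : (A : Matrix (Fin n) (Fin n) F).mulVec v = μ • v) (k : ℤ) :
    ((A ^ k : GL (Fin n) F) : Matrix (Fin n) (Fin n) F).mulVec v = μ ^ k • v := by
  have hpow (A : GL (Fin n) F) (μ : F) (h : (A : Matrix (Fin n) (Fin n) F).mulVec v = μ • v)
      (m : ℕ) : ((A ^ m : GL (Fin n) F) : Matrix (Fin n) (Fin n) F).mulVec v = μ ^ m • v := by
    induction m with
    | zero => simp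
    | succ m ih =>
      rw [pow_succ, Units.val_mul, ← Matrix.mulVec_mulVec, h, Matrix.mulVec_smul, ih, smul_smul,
        pow_succ, mul_comm]
  cases k with
  | ofNat m => simpa using hpow A μ h m
  | negSucc m =>
    rw [zpow_negSucc, ← inv_pow, zpow_negSucc, ← inv_pow]
    exact hpow _ _ (mulVec_inv_of_mulVec hμ h) _

theorem mulVec_list_prod_of_mulVec {v : Fin n → F} (s : ℕ) (B : Fin s → GL (Fin n) F)
    (μ : Fin s → F) (h : ∀ i, (B i : Matrix (Fin n) (Fin n) F).mulVec v = μ i • v) :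
    (((List.ofFn B).prod : GL (Fin n) F) : Matrix (Fin n) (Fin n) F).mulVec v = (∏ i, μ i) • v := by
  induction s with
  | zero => simp
  | succ s ih =>
    rw [List.ofFn_succ, List.prod_cons, Units.val_mul, ← Matrix.mulVec_mulVec,
      ih _ (fun i => μ i.succ) fun i => h i.succ, Matrix.mulVec_smul, h, smul_smul,
      Fin.prod_univ_succ, mul_comm]

/-- A product of powers of commuting diagonalizable matrices is trivial if and only if all the
products of joint eigenvalues are. -/
theorem list_prod_zpow_eq_one_iff (A : Fin s → GL (Fin n) F) (hcomm : ∀ i j, Commute (A i) (A j))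
    (hdiag : ∀ i, ∃ (T : GL (Fin n) F) (d : Fin n → F), (A i : Matrix (Fin n) (Fin n) F) =
      (T : Matrix (Fin n) (Fin n) F) * Matrix.diagonal d * (T⁻¹ : GL (Fin n) F)) (k : Fin s → ℤ) :
    (List.ofFn fun i => A i ^ k i).prod = 1 ↔
      ∀ χ, IsJointEigenvalue (fun i => (A i : Matrix (Fin n) (Fin n) F)) χ →
        ∏ i, χ i ^ k i = 1 := by
  have hact {χ : Fin s → F} {v : Fin n → F} (hv : v ≠ 0)
      (h : ∀ i, (A i : Matrix (Fin n) (Fin n) F).mulVec v = χ i • v) :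
      (((List.ofFn fun i => A i ^ k i).prod : GL (Fin n) F) : Matrix (Fin n) (Fin n) F).mulVec v =
        (∏ i, χ i ^ k i) • v :=
    mulVec_list_prod_of_mulVec s _ _ fun i =>
      mulVec_zpow_of_mulVec (ne_zero_of_mulVec_eq_smul hv (h i)) (h i) (k i)
  constructor
  · rintro h χ ⟨v, hv, hχ⟩
    have h1 := hact hv hχ
    rw [h, Units.val_one, Matrix.one_mulVec] at h1
    have h2 : (1 - ∏ i, χ i ^ k i) • v = 0 := by rw [sub_smul, one_smul, ← h1, sub_self]
    exact (sub_eq_zero.mp ((smul_eq_zero.mp h2).resolve_right hv)).symm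
  · intro h
    have hss (i : Fin s) : Module.End.IsSemisimple (Matrix.toLin' (A i : Matrix (Fin n) (Fin n) F)) ∧
        ⨆ μ, Module.End.eigenspace (Matrix.toLin' (A i : Matrix (Fin n) (Fin n) F)) μ = ⊤ := by
      obtain ⟨T, d, hT⟩ := hdiag i
      exact Matrix.toLin'_isSemisimple_of_eq_mul_diagonal_mul_inv hT
    -- By commutativity the joint generalized eigenspaces span; by semisimplicity their nonzero
    -- vectors are joint eigenvectors, on which the product acts by `∏ χ_i ^ k_i`.
    have htop := Module.End.iSup_iInf_maxGenEigenspace_eq_top_of_iSup_maxGenEigenspace_eq_top_of_commute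
      (fun i => Matrix.toLin' (A i : Matrix (Fin n) (Fin n) F)) (fun i j _ => by
        change _ * _ = _ * _
        rw [Module.End.mul_eq_comp, Module.End.mul_eq_comp, ← Matrix.toLin'_mul,
          ← Matrix.toLin'_mul, ← Units.val_mul, ← Units.val_mul, (hcomm i j).eq])
      (fun i => (hss i).1.iSup_maxGenEigenspace_eq_top_iff.mpr (hss i).2)
    have hker : LinearMap.ker (Matrix.toLin' (((List.ofFn fun i => A i ^ k i).prod : GL (Fin n) F) :
        Matrix (Fin n) (Fin n) F) - LinearMap.id) = ⊤ := by
      rw [eq_top_iff, ← htop]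
      refine iSup_le fun χ v hv => ?_
      rw [LinearMap.mem_ker, LinearMap.sub_apply, Matrix.toLin'_apply, LinearMap.id_apply,
        sub_eq_zero]
      by_cases hv0 : v = 0
      · rw [hv0, Matrix.mulVec_zero]
      have hχ (i : Fin s) : (A i : Matrix (Fin n) (Fin n) F).mulVec v = χ i • v := by
        have h1 := (Submodule.mem_iInf _).mp hv i
        rw [(hss i).1.isFinitelySemisimple.maxGenEigenspace_eq_eigenspace,
          Module.End.mem_eigenspace_iff, Matrix.toLin'_apply] at h1
        exact h1
      rw [hact hv0 hχ, h χ ⟨v, hv0, hχ⟩, one_smul]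
    rw [LinearMap.ker_eq_top, sub_eq_zero] at hker
    apply Units.ext
    rw [Units.val_one]
    apply Matrix.toLin'.injective
    rw [hker, Matrix.toLin'_one]

end JointEigenvectors

/-! ### Uniform degree and height bounds for the relation lattice -/

theorem IntermediateField.finrank_biSup_adjoin_simple_le {K E : Type*} [Field K] [Field E]
    [Algebra K E] {ι : Type*} (x : ι → E) (hx : ∀ i, IsIntegral K (x i)) {n : ℕ}
    (hn : ∀ i, (minpoly K (x i)).natDegree ≤ n) (t : Finset ι) :
    Module.finrank K (⨆ i ∈ t, IntermediateField.adjoin K {x i} : IntermediateField K E) ≤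
      n ^ t.card := by
  classical
  induction t using Finset.induction_on with
  | empty =>
    have h : (⨆ i ∈ (∅ : Finset ι), IntermediateField.adjoin K {x i} : IntermediateField K E) = ⊥ := by
      simp
    rw [h, IntermediateField.finrank_bot, Finset.card_empty, pow_zero]
  | insert a t ha ih =>
    rw [Finset.iSup_insert, Finset.card_insert_of_notMem ha, pow_succ']
    refine (IntermediateField.finrank_sup_le _ _).trans (Nat.mul_le_mul ?_ ih)
    rw [IntermediateField.adjoin.finrank (hx a)]
    exact hn a

open Height in
/-- The logarithmic height of `∏ i, x i ^ k i` as a seminorm in `k`. -/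
theorem NumberField.exists_seminorm_of_logHeight₁_le {L : Type*} [Field L] [NumberField L] {s : ℕ}
    (x : Fin s → L) (hx : ∀ i, x i ≠ 0) {h η : ℝ} (hh : ∀ i, logHeight₁ (x i) ≤ h) {ω : ℕ}
    (htors : ∀ y : L, y ≠ 0 → logHeight₁ y < η → y ^ ω = 1) :
    ∃ N : (Fin s → ℤ) → ℝ, (∀ (d : ℤ) k, N (d • k) = |(d : ℝ)| * N k) ∧
      (∀ w, ∏ i, x i ^ w i = 1 → ∀ k, N (k - w) = N k) ∧
      (∀ k, N k ≤ h * ∑ i, |(k i : ℝ)|) ∧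
      ∀ k, N k < η → ∏ i, x i ^ ((ω : ℤ) • k) i = 1 := by
  have hsmul (d : ℤ) (k : Fin s → ℤ) : ∏ i, x i ^ (d • k) i = (∏ i, x i ^ k i) ^ d := by
    rw [← Finset.prod_zpow]
    refine Finset.prod_congr rfl fun i _ => ?_
    rw [Pi.smul_apply, smul_eq_mul, mul_comm, zpow_mul]
  refine ⟨fun k => logHeight₁ (∏ i, x i ^ k i), fun d k => ?_, fun w hw k => ?_, fun k => ?_,
    fun k hk => ?_⟩
  · simp only [hsmul, logHeight₁_zpow, Nat.cast_natAbs, Int.cast_abs]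
  · have h1 : ∏ i, x i ^ (k - w) i = (∏ i, x i ^ k i) / ∏ i, x i ^ w i := by
      rw [← Finset.prod_div_distrib]
      exact Finset.prod_congr rfl fun i _ => zpow_sub₀ (hx i) _ _
    simp only [h1, hw, div_one]
  · refine (logHeight₁_prod_le _ _).trans ?_
    rw [Finset.mul_sum]
    refine Finset.sum_le_sum fun i _ => ?_
    rw [logHeight₁_zpow, Nat.cast_natAbs, Int.cast_abs, mul_comm]
    exact mul_le_mul_of_nonneg_right (hh i) (abs_nonneg _)
  · rw [hsmul, zpow_natCast]
    exact htors _ (Finset.prod_ne_zero_iff.mpr fun i _ => zpow_ne_zero _ (hx i)) hk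

/-- Roots of the characteristic polynomials of `s` matrices of size `n` over `K` lie in an extension
of degree at most `n ^ s`. -/
theorem NumberField.exists_intermediateField_of_aeval_charpoly_eq_zero {K : Type*} [Field K]
    [NumberField K] {n s : ℕ} (A : Fin s → Matrix (Fin n) (Fin n) K)
    (χ : Fin s → AlgebraicClosure K) (hχ : ∀ i, Polynomial.aeval (χ i) (A i).charpoly = 0) :
    ∃ L : IntermediateField K (AlgebraicClosure K), NumberField L ∧
      Module.finrank ℚ L ≤ Module.finrank ℚ K * n ^ s ∧ ∀ i, χ i ∈ L := by
  have hint (i : Fin s) : IsIntegral K (χ i) := Algebra.IsIntegral.isIntegral _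
  have hdeg (i : Fin s) : (minpoly K (χ i)).natDegree ≤ n := by
    have := Polynomial.natDegree_le_of_dvd (minpoly.dvd K _ (hχ i)) (A i).charpoly_monic.ne_zero
    simpa [Matrix.charpoly_natDegree_eq_dim] using this
  have hrank := IntermediateField.finrank_biSup_adjoin_simple_le χ hint hdeg Finset.univ
  have heq : (⨆ i ∈ Finset.univ, IntermediateField.adjoin K {χ i} :
      IntermediateField K (AlgebraicClosure K)) = ⨆ i, IntermediateField.adjoin K {χ i} := by
    simp
  rw [heq, Finset.card_univ, Fintype.card_fin] at hrank
  have (i : Fin s) : FiniteDimensional K (IntermediateField.adjoin K {χ i}) :=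
    IntermediateField.adjoin.finiteDimensional (hint i)
  have hfin : FiniteDimensional K (⨆ i, IntermediateField.adjoin K {χ i} :
      IntermediateField K (AlgebraicClosure K)) :=
    IntermediateField.finiteDimensional_iSup_of_finite
  refine ⟨⨆ i, IntermediateField.adjoin K {χ i},
    { to_charZero := inferInstance, to_finiteDimensional := Module.Finite.trans K _ }, ?_,
    fun i => ?_⟩
  · rw [← Module.finrank_mul_finrank ℚ K]
    exact Nat.mul_le_mul_left _ hrank
  · exact le_iSup (fun i => IntermediateField.adjoin K {χ i}) i
      (IntermediateField.mem_adjoin_simple_self K (χ i))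

-- The homogeneous coordinate `1` makes `(a_ij : 1)` a subtuple of the projective point. The
-- exponent passes from absolute to relative height.
open Height in
theorem mulHeight₁_apply_le_of_matrixHeight_le {K : Type*} [Field K] [NumberField K] {n : ℕ}
    {A : Matrix (Fin n) (Fin n) K} {Y : ℝ} (hA : matrixHeight A ≤ Y) (i j : Fin n) :
    mulHeight₁ (A i j) ≤ Y ^ Module.finrank ℚ K := by
  set x : Option (Fin n × Fin n) → K := fun o => o.elim (1 : K) (fun p => A p.1 p.2) with hx
  have h1 : mulHeight₁ (A i j) ≤ mulHeight x := by
    have h2 : ![A i j, 1] = x ∘ ![some (i, j), none] := by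
      ext a
      fin_cases a <;> simp [hx]
    rw [mulHeight₁_eq_mulHeight, h2]
    exact mulHeight_comp_le _ _
  refine h1.trans ?_
  have h3 : mulHeight x = matrixHeight A ^ Module.finrank ℚ K := by
    rw [matrixHeight, ← hx, ← Real.rpow_natCast, ← Real.rpow_mul (mulHeight_pos x).le,
      inv_mul_cancel₀ (by exact_mod_cast Module.finrank_pos.ne'), Real.rpow_one]
  rw [h3]
  exact pow_le_pow_left₀ (Real.rpow_nonneg (mulHeight_pos x).le _) hA _

/-- Joint eigenvalues over the algebraic closure are roots of the characteristic polynomials. -/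
theorem aeval_charpoly_eq_zero_of_isJointEigenvalue {K E : Type*} [Field K] [Field E] [Algebra K E]
    {n s : ℕ} {A : Fin s → Matrix (Fin n) (Fin n) K} {χ : Fin s → E}
    (hχ : IsJointEigenvalue (fun i => (A i).map (algebraMap K E)) χ) (i : Fin s) :
    Polynomial.aeval (χ i) (A i).charpoly = 0 := by
  obtain ⟨v, hv, h⟩ := hχ
  rw [Polynomial.aeval_def, ← Polynomial.eval_map, ← Matrix.charpoly_map, ← Polynomial.IsRoot,
    ← Matrix.charpoly_toLin', ← Module.End.hasEigenvalue_iff_isRoot_charpoly]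
  refine Module.End.hasEigenvalue_of_hasEigenvector (x := v) ⟨?_, hv⟩
  rw [Module.End.mem_eigenspace_iff, Matrix.toLin'_apply]
  exact h i

open Height in
/-- For matrices with entries of bounded height, the relations between the joint eigenvalues for a
given joint eigenvector are discrete for a bounded seminorm. -/
theorem exists_seminorm_of_isJointEigenvalue {K : Type*} [Field K] [NumberField K] {n s : ℕ}
    {A : Fin s → GL (Fin n) K} {X : ℝ} (hX : 1 ≤ X)
    (hA : ∀ i j l, mulHeight₁ ((A i : Matrix (Fin n) (Fin n) K) j l) ≤ X)
    {h η : ℝ} {ω : ℕ}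
    (hh : (Module.finrank ℚ K * n ^ s : ℕ) * Real.log ((n + 1) * X ^ (2 * (n * n) + 1)) ≤ h)
    (htors : ∀ (L : IntermediateField K (AlgebraicClosure K)) [NumberField L],
      Module.finrank ℚ L ≤ Module.finrank ℚ K * n ^ s →
        ∀ y : L, y ≠ 0 → logHeight₁ y < η → y ^ ω = 1)
    {χ : Fin s → AlgebraicClosure K}
    (hχ : IsJointEigenvalue
      (fun i => (A i : Matrix (Fin n) (Fin n) K).map (algebraMap K (AlgebraicClosure K))) χ) :
    ∃ N : (Fin s → ℤ) → ℝ, (∀ (d : ℤ) k, N (d • k) = |(d : ℝ)| * N k) ∧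
      (∀ w, ∏ i, χ i ^ w i = 1 → ∀ k, N (k - w) = N k) ∧
      (∀ k, N k ≤ h * ∑ i, |(k i : ℝ)|) ∧
      ∀ k, N k < η → ∏ i, χ i ^ ((ω : ℤ) • k) i = 1 := by
  have haeval := aeval_charpoly_eq_zero_of_isJointEigenvalue hχ
  obtain ⟨L, _, hD, hmem⟩ :=
    NumberField.exists_intermediateField_of_aeval_charpoly_eq_zero _ χ haeval
  let x : Fin s → L := fun i => ⟨χ i, hmem i⟩
  have hx0 (i : Fin s) : x i ≠ 0 := by
    obtain ⟨v, hv, hχv⟩ := hχ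
    have := ne_zero_of_mulVec_eq_smul
      (A := Matrix.GeneralLinearGroup.map (algebraMap K (AlgebraicClosure K)) (A i)) hv (hχv i)
    exact fun h0 => this (congrArg Subtype.val h0)
  have hroot (i : Fin s) :
      Polynomial.aeval (x i) (A i : Matrix (Fin n) (Fin n) K).charpoly = 0 := by
    apply (algebraMap L (AlgebraicClosure K)).injective
    rw [map_zero, ← Polynomial.aeval_algebraMap_apply]
    exact haeval i
  have hlog (i : Fin s) : logHeight₁ (x i) ≤ h := by
    refine le_trans ?_ hh
    have h1 := NumberField.mulHeight₁_le_of_aeval_charpoly_eq_zero _ hX (hA i) (hroot i)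
    rw [logHeight₁_eq_log_mulHeight₁]
    refine (Real.log_le_log (mulHeight₁_pos _) h1).trans ?_
    rw [Real.log_pow]
    refine mul_le_mul_of_nonneg_right (by exact_mod_cast hD) (Real.log_nonneg ?_)
    exact one_le_mul_of_one_le_of_one_le (by linarith [Nat.cast_nonneg (α := ℝ) n])
      (one_le_pow₀ hX)
  obtain ⟨N, h1, h2, h3, h4⟩ :=
    NumberField.exists_seminorm_of_logHeight₁_le x hx0 hlog (htors L hD)
  have hval (k : Fin s → ℤ) : ((∏ i, x i ^ k i : L) : AlgebraicClosure K) = ∏ i, χ i ^ k i := by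
    change algebraMap L (AlgebraicClosure K) _ = _
    rw [map_prod]
    exact Finset.prod_congr rfl fun i _ => map_zpow₀ _ _ _
  refine ⟨N, h1, fun w hw => h2 w ?_, h3, fun k hk => ?_⟩
  · apply (algebraMap L (AlgebraicClosure K)).injective
    rw [map_one]
    exact (hval w).trans hw
  · rw [← hval, h4 k hk]
    rfl

/-- The relation lattice of a tuple of matrices is the relation lattice of its joint
eigenvalues. -/
theorem list_prod_zpow_eq_one_iff_of_isDiagonalizableMatrix {K : Type*} [Field K] {n s : ℕ}
    (A : Fin s → GL (Fin n) K) (hcomm : ∀ i j, Commute (A i) (A j))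
    (hdiag : ∀ i, IsDiagonalizableMatrix (A i : Matrix (Fin n) (Fin n) K)) (k : Fin s → ℤ) :
    (List.ofFn fun i => A i ^ k i).prod = 1 ↔
      ∀ χ, IsJointEigenvalue (fun i =>
          (A i : Matrix (Fin n) (Fin n) K).map (algebraMap K (AlgebraicClosure K))) χ →
        ∏ i, χ i ^ k i = 1 := by
  have hinj : Function.Injective (Matrix.GeneralLinearGroup.map (n := Fin n)
      (algebraMap K (AlgebraicClosure K))) := by
    intro B C hBC
    apply Units.ext
    apply Matrix.map_injective (algebraMap K (AlgebraicClosure K)).injective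
    exact congrArg Units.val hBC
  rw [← hinj.eq_iff, map_one, map_list_prod, List.map_ofFn]
  have h := list_prod_zpow_eq_one_iff
    (fun i => Matrix.GeneralLinearGroup.map (algebraMap K (AlgebraicClosure K)) (A i))
    (fun i j => (hcomm i j).map _) hdiag k
  have hcomp : (⇑(Matrix.GeneralLinearGroup.map (n := Fin n)
      (algebraMap K (AlgebraicClosure K))) ∘ fun i => A i ^ k i) = fun i =>
        Matrix.GeneralLinearGroup.map (algebraMap K (AlgebraicClosure K)) (A i) ^ k i :=
    funext fun i => map_zpow _ _ _
  rw [hcomp]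
  exact h

/-! ### Choice of constants and conclusion -/

theorem theorem2 (K : Type*) [Field K] [NumberField K] (n s : ℕ) (hs : 2 ≤ s)
    (c : ℝ) (hc : 0 < c) :
    ∃ R : ℕ, 0 < R ∧ R < s ∧ ∃ C : ℝ, 0 < C ∧
      ∀ H : ℝ, 2 ≤ H → ∀ A : Fin s → GL (Fin n) K,
        (∀ i j, Commute (A i) (A j)) →
        (∀ i, IsDiagonalizableMatrix (A i : Matrix (Fin n) (Fin n) K)) →
        (∀ i, matrixHeight (A i : Matrix (Fin n) (Fin n) K) ≤ c * H) →
        (∃ k : Fin s → ℤ, IsMulRelation A k) →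
        ∃ k : Fin s → ℤ, IsMulRelation A k ∧ ∀ i, |(k i : ℝ)| ≤ C * Real.log H ^ R := by
  obtain ⟨ω, hω, η, hη, htors⟩ :=
    NumberField.exists_forall_pow_eq_one_of_logHeight₁_lt (Module.finrank ℚ K * n ^ s)
  set D : ℝ := ((Module.finrank ℚ K * n ^ s : ℕ) : ℝ) with hD
  set d := Module.finrank ℚ K with hd
  set c' := max c 1 with hc'
  have hc1 : 1 ≤ c' := le_max_right _ _
  have hD0 : 0 ≤ D := Nat.cast_nonneg _
  have hn0 : (1 : ℝ) ≤ n + 1 := by linarith [Nat.cast_nonneg (α := ℝ) n]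
  -- `a + b * log H` is the eigenvalue height bound for `X = (c' * H) ^ d`; `c' ≥ 1` keeps `log c'`
  -- nonnegative. It is at most `(2 * a + b) * log H` since `1 ≤ 2 * log H`.
  set a := D * (Real.log (n + 1) + ((2 * (n * n) + 1 : ℕ) : ℝ) * (d * Real.log c')) with ha
  set b := D * (((2 * (n * n) + 1 : ℕ) : ℝ) * d) with hb
  have ha0 : 0 ≤ a := mul_nonneg hD0 (add_nonneg (Real.log_nonneg hn0)
    (mul_nonneg (Nat.cast_nonneg _) (mul_nonneg (Nat.cast_nonneg _) (Real.log_nonneg hc1))))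
  have hb0 : 0 ≤ b := by positivity
  -- Chosen so that `T ≤ C₂ * log H`; the summand `2` absorbs the `+ 1` after the floor in `T`.
  set C₂ := s * (2 * a + b) / η + 2 with hC₂
  have hC₂0 : 0 ≤ C₂ := by positivity
  have hs0 : (0 : ℝ) < s := by exact_mod_cast (by omega : 0 < s)
  have hω0 : (0 : ℝ) < ω := by exact_mod_cast hω
  refine ⟨s - 1, by omega, by omega,
    s * ((s * s + 1) ^ s * (ω * (C₂ ^ (s - 1) + 2 ^ (s - 1)))), by positivity, ?_⟩
  intro H hH A hcomm hdiag hheight hrel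
  have hlog : 1 ≤ 2 * Real.log H := by
    have h1 := Real.log_le_log (by norm_num) hH
    linarith [Real.log_two_gt_d9]
  have hlog0 : 0 ≤ Real.log H := by linarith
  set X := (c' * H) ^ d with hXdef
  have hX : 1 ≤ X := one_le_pow₀ (one_le_mul_of_one_le_of_one_le hc1 (by linarith))
  have hentry (i : Fin s) (j l : Fin n) :
      Height.mulHeight₁ ((A i : Matrix (Fin n) (Fin n) K) j l) ≤ X :=
    mulHeight₁_apply_le_of_matrixHeight_le ((hheight i).trans
      (mul_le_mul_of_nonneg_right (le_max_left _ _) (by linarith))) j l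
  set h := (2 * a + b) * Real.log H with hh
  have hh0 : 0 ≤ h := by positivity
  have hhX : D * Real.log ((n + 1) * X ^ (2 * (n * n) + 1)) ≤ h := by
    have h1 : D * Real.log ((n + 1) * X ^ (2 * (n * n) + 1)) = a + b * Real.log H := by
      rw [Real.log_mul (by positivity) (by positivity), Real.log_pow, hXdef, Real.log_pow,
        Real.log_mul (by positivity) (by positivity), ha, hb]
      ring
    rw [h1, hh]
    nlinarith
  let T : ℕ := ⌊s * h / η⌋₊ + 1
  have hT : s * h < η * T := by
    have h1 := Nat.lt_floor_add_one (s * h / η)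
    rw [div_lt_iff₀ hη] at h1
    simpa [T, mul_comm] using h1
  have hTle : (T : ℝ) ≤ C₂ * Real.log H := by
    have h1 : ((⌊s * h / η⌋₊ : ℕ) : ℝ) ≤ s * h / η := Nat.floor_le (by positivity)
    have h2 : s * h / η = s * (2 * a + b) / η * Real.log H := by
      rw [hh]
      ring
    simp only [T, Nat.cast_add, Nat.cast_one]
    rw [hC₂, add_mul]
    linarith
  have hiff := list_prod_zpow_eq_one_iff_of_isDiagonalizableMatrix A hcomm hdiag
  choose! N hN1 hN2 hN3 hN4 using fun (χ : {χ : Fin s → AlgebraicClosure K // IsJointEigenvalue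
      (fun i => (A i : Matrix (Fin n) (Fin n) K).map (algebraMap K (AlgebraicClosure K))) χ}) =>
    exists_seminorm_of_isJointEigenvalue hX hentry hhX
      (fun L _ hL y hy0 hy => htors L hL y hy0 hy) χ.2
  have hne (χ : Fin s → AlgebraicClosure K) (hχ : IsJointEigenvalue
      (fun i => (A i : Matrix (Fin n) (Fin n) K).map (algebraMap K (AlgebraicClosure K))) χ)
      (i : Fin s) : χ i ≠ 0 := by
    obtain ⟨v, hv, hχv⟩ := hχ
    exact ne_zero_of_mulVec_eq_smul
      (A := Matrix.GeneralLinearGroup.map (algebraMap K (AlgebraicClosure K)) (A i)) hv (hχv i)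
  let Λ : AddSubgroup (Fin s → ℤ) :=
    { carrier := {k | ∀ χ, IsJointEigenvalue (fun i =>
          (A i : Matrix (Fin n) (Fin n) K).map (algebraMap K (AlgebraicClosure K))) χ →
        ∏ i, χ i ^ k i = 1}
      zero_mem' := fun χ _ => by simp
      add_mem' := fun {k l} hk hl χ hχ => by
        simp only [Pi.add_apply, zpow_add₀ (hne χ hχ _), Finset.prod_mul_distrib]
        rw [hk χ hχ, hl χ hχ, one_mul]
      neg_mem' := fun {k} hk χ hχ => by
        simp only [Pi.neg_apply, zpow_neg, Finset.prod_inv_distrib]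
        rw [hk χ hχ, inv_one] }
  obtain ⟨w, hw0, hw⟩ := hrel
  obtain ⟨k, hk, hk0, hkb⟩ := exists_small_mem_forall_ne_zero Λ N hω hh0 hN1
    (fun χ w hw => hN2 χ w (hw χ χ.2)) hN3 (fun k hk χ hχ => hN4 ⟨χ, hχ⟩ k (hk ⟨χ, hχ⟩))
    (Nat.succ_pos _) hT ((hiff w).mp hw) hw0
  refine ⟨k, ⟨hk0, (hiff k).mpr hk⟩, fun i => (hkb i).trans ?_⟩
  have h1 : (T : ℝ) ^ (s - 1) + 1 ≤ (C₂ ^ (s - 1) + 2 ^ (s - 1)) * Real.log H ^ (s - 1) := by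
    rw [add_mul, ← mul_pow, ← mul_pow]
    exact add_le_add (pow_le_pow_left₀ (Nat.cast_nonneg _) hTle _) (one_le_pow₀ hlog)
  calc (s : ℝ) * ((s * s + 1) ^ s * (ω * ((T : ℝ) ^ (s - 1) + 1)))
      ≤ s * ((s * s + 1) ^ s *
          (ω * ((C₂ ^ (s - 1) + 2 ^ (s - 1)) * Real.log H ^ (s - 1)))) := by gcongr
    _ = _ := by ring
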